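/- Recall that the weight $w(Z)$ of a topological space $Z$ is the least cardinality of a base of its topology, and that $Z$ is homogeneous if for all $x,y\in Z$ there is a homeomorphism $h\colon Z\to Z$ with $h(x)=y$. All spaces are assumed to be Tychonoff (completely regular and $T_1$). **Theorem 3.1.** There is a homogeneous space $X$ of weight $\mathfrak{c}=2^{\aleph_0}$ such that if $Y$ is a space, $f\colon X\to Y$ is a continuous surjection and $\omega<w(Y)<\mathfrak{c}$, then $Y$ is not homogeneous. -/

import Mathlib

open Cardinal Topology

universe u

/-- The weight `w(X)` of a topological space: the least cardinality of a base of its topology. -/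
noncomputable def topWeight (X : Type u) [TopologicalSpace X] : Cardinal.{u} :=
  sInf {κ : Cardinal.{u} | ∃ B : Set (Set X), TopologicalSpace.IsTopologicalBasis B ∧ #B = κ}

/-- A space is (topologically) homogeneous if for any two points some homeomorphism of the space
onto itself takes the first to the second. -/
def IsHomogeneousSpace (X : Type u) [TopologicalSpace X] : Prop :=
  ∀ x y : X, ∃ h : X ≃ₜ X, h x = y

open Set Filter

/-! A Mrówka family is a maximal almost disjoint family of size `𝔠` such that every continuous
`[0,1]`-valued function on its Ψ-space has a single limit at infinity. The space is that Ψ-space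
with each isolated point replaced by a Cantor set. It is covered by clopen Cantor sets, the pieces;
exchanging disjoint ones gives homogeneity. Each limit point lies in exactly one piece, so fewer
than `𝔠` finite sets of pieces cannot cover.

For `f` onto `Y` of weight below `𝔠`, this yields a point `y₀` such that, for each neighbourhood of
`y₀`, all of the space outside finitely many pieces is mapped into it
(`exists_limit_of_small_weight`). A point other than `y₀` then has a neighbourhood inside a compact
second countable image of finitely many pieces. Homogeneity gives every point a second countable
neighbourhood, and since the complement of one around `y₀` lies in a compact set, finitely many
suffice: `Y` has countable weight (`topWeight_le_aleph0_of_homogeneous`).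

The combinatorial core is `exists_mrowka_family`: members of a maximal almost disjoint family are
glued in pairs, one pair for each function that threatens to have two separated large sets of
limits. -/

/-! ### Almost disjoint families and Mrówka's construction -/

theorem exists_maximal_almostDisjoint (R : Set (Set ℕ)) (hinf : ∀ a ∈ R, a.Infinite)
    (hR : R.Pairwise fun a b => (a ∩ b).Finite) :
    ∃ 𝓜 : Set (Set ℕ), R ⊆ 𝓜 ∧ (𝓜.Pairwise fun a b => (a ∩ b).Finite) ∧
      ∀ M : Set ℕ, M.Infinite → ∃ a ∈ 𝓜, (M ∩ a).Infinite := by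
  obtain ⟨𝓜, hsub, hmax⟩ := zorn_subset_nonempty
    {𝓕 : Set (Set ℕ) | (∀ a ∈ 𝓕, a.Infinite) ∧ 𝓕.Pairwise fun a b => (a ∩ b).Finite}
    (by
      intro c hc hchain _
      refine ⟨⋃₀ c, ⟨?_, ?_⟩, fun s hs => subset_sUnion_of_mem hs⟩
      · rintro a ⟨s, hs, ha⟩
        exact (hc hs).1 a ha
      · exact (pairwise_sUnion hchain.directedOn).2 fun s hs => (hc hs).2) R ⟨hinf, hR⟩
  refine ⟨𝓜, hsub, hmax.prop.2, fun M hM => ?_⟩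
  by_contra! h
  have hins : insert M 𝓜 ∈ {𝓕 : Set (Set ℕ) | (∀ a ∈ 𝓕, a.Infinite) ∧
      𝓕.Pairwise fun a b => (a ∩ b).Finite} := by
    refine ⟨?_, ?_⟩
    · rintro a (rfl | ha)
      · exact hM
      · exact hmax.prop.1 a ha
    · refine hmax.prop.2.insert fun b hb _ => ⟨h b hb, ?_⟩
      rw [inter_comm]
      exact h b hb
  have hmem : M ∈ 𝓜 := hmax.le_of_ge hins (subset_insert _ _) (mem_insert _ _)
  have := h M hmem
  rw [inter_self] at this
  exact hM this

/-- The code of the initial segment of length `n` of a point of the Cantor space. -/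
def branchCode (x : ℕ → Bool) (n : ℕ) : ℕ := Encodable.encode ((List.range n).map x)

theorem branchCode_eq_iff {x y : ℕ → Bool} {n m : ℕ} :
    branchCode x n = branchCode y m ↔ n = m ∧ ∀ k < n, x k = y k := by
  unfold branchCode
  rw [Encodable.encode_inj]
  constructor
  · intro h
    have hl := congrArg List.length h
    simp only [List.length_map, List.length_range] at hl
    subst hl
    refine ⟨rfl, fun k hk => ?_⟩
    exact List.map_inj_left.1 h k (List.mem_range.2 hk)
  · rintro ⟨rfl, h⟩
    exact List.map_inj_left.2 fun k hk => h k (List.mem_range.1 hk)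

theorem branchCode_injective (x : ℕ → Bool) : Function.Injective (branchCode x) :=
  fun _ _ h => (branchCode_eq_iff.1 h).1

theorem range_branchCode_inter_finite {x y : ℕ → Bool} (h : x ≠ y) :
    (range (branchCode x) ∩ range (branchCode y)).Finite := by
  obtain ⟨k, hk⟩ := Function.ne_iff.1 h
  refine ((finite_Iic k).image (branchCode x)).subset ?_
  rintro _ ⟨⟨n, rfl⟩, ⟨m, hm⟩⟩
  refine ⟨n, ?_, rfl⟩
  by_contra hn
  obtain ⟨rfl, h'⟩ := branchCode_eq_iff.1 hm
  exact hk (h' k (not_le.1 hn)).symm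

theorem range_branchCode_injective :
    Function.Injective fun x : ℕ → Bool => range (branchCode x) := by
  intro x y h
  by_contra hxy
  have := range_branchCode_inter_finite hxy
  simp only at h
  rw [← h, inter_self] at this
  exact infinite_range_of_injective (branchCode_injective x) this

theorem eventually_eq_below (c : ℕ → Bool) (N : ℕ) : ∀ᶠ d in 𝓝 c, ∀ k < N, d k = c k := by
  have h : ∀ᶠ d in 𝓝 c, ∀ k ∈ Finset.range N, d k = c k := by
    rw [Filter.eventually_all_finset]
    intro k _
    exact (continuous_apply k).continuousAt.eventually (isOpen_discrete {c k} |>.mem_nhds rfl)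
  simpa using h

/-- Makes limits along branches Borel functions of the branch, which is why the family is built on
branches. -/
theorem continuous_comp_branchCode (f : ℕ → ℝ) (n : ℕ) :
    Continuous fun x : ℕ → Bool => f (branchCode x n) := by
  refine IsLocallyConstant.continuous ((IsLocallyConstant.iff_eventually_eq _).2 fun x => ?_)
  filter_upwards [eventually_eq_below x n] with y hy
  congr 1
  exact branchCode_eq_iff.2 ⟨rfl, hy⟩

/-- A maximal almost disjoint family indexed by the Cantor space whose members contain the
corresponding branches of the binary tree. -/
theorem exists_almostDisjoint_branches :
    ∃ E : (ℕ → Bool) → Set ℕ, (∀ x, range (branchCode x) ⊆ E x) ∧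
      (∀ x y, x ≠ y → (E x ∩ E y).Finite) ∧
      ∀ M : Set ℕ, M.Infinite → ∃ x, (M ∩ E x).Infinite := by
  obtain ⟨𝓜, hR, hAD, hmax⟩ := exists_maximal_almostDisjoint
    (range fun x : ℕ → Bool => range (branchCode x))
    (by
      rintro _ ⟨x, rfl⟩
      exact infinite_range_of_injective (branchCode_injective x))
    (by
      rintro _ ⟨x, rfl⟩ _ ⟨y, rfl⟩ h
      exact range_branchCode_inter_finite fun hxy => h (by rw [hxy]))
  set N : Set (Set ℕ) := 𝓜 \ range fun x : ℕ → Bool => range (branchCode x)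
  have hRM : ∀ x, range (branchCode x) ∈ 𝓜 := fun x => hR ⟨x, rfl⟩
  have hRN : ∀ x s, s ∈ N → (range (branchCode x) ∩ s).Finite := fun x s hs =>
    hAD (hRM x) hs.1 fun h => hs.2 ⟨x, h⟩
  let D : (ℕ → Bool) → Set ℕ := fun x => {n | x n = true}
  have hD : Function.Injective D := by
    intro x y h
    funext n
    have := Set.ext_iff.1 h n
    exact Bool.eq_iff_iff.2 this
  -- Members that are not branches are absorbed by branches: `x`, read as a characteristic function,
  -- takes in the set it codes. Distinct `x` absorb distinct sets, so almost disjointness survives.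
  refine ⟨fun x => range (branchCode x) ∪ {n | n ∈ D x ∧ D x ∈ N},
    fun x => subset_union_left, fun x y hxy => ?_, fun M hM => ?_⟩
  · rw [union_inter_distrib_right, inter_union_distrib_left, inter_union_distrib_left]
    refine (((range_branchCode_inter_finite hxy).union ?_).union (Finite.union ?_ ?_))
    · by_cases h : D y ∈ N
      · exact (hRN x _ h).subset (inter_subset_inter_right _ fun n hn => hn.1)
      · simp [h]
    · by_cases h : D x ∈ N
      · exact (hRN y _ h).subset fun n hn => ⟨hn.2, hn.1.1⟩
      · simp [h]
    · by_cases h : D x ∈ N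
      · by_cases h' : D y ∈ N
        · exact (hAD h.1 h'.1 (hD.ne hxy)).subset
            (inter_subset_inter (fun n hn => hn.1) fun n hn => hn.1)
        · simp [h']
      · simp [h]
  · obtain ⟨a, ha, hMa⟩ := hmax M hM
    by_cases h : a ∈ range fun x : ℕ → Bool => range (branchCode x)
    · obtain ⟨x, rfl⟩ := h
      exact ⟨x, hMa.mono (inter_subset_inter_right _ subset_union_left)⟩
    · classical
      have hDa : D (fun n => decide (n ∈ a)) = a := by
        ext n
        simp [D]
      refine ⟨fun n => decide (n ∈ a), hMa.mono (inter_subset_inter_right _ fun n hn => Or.inr ?_)⟩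
      simp only [mem_ofPred_eq, hDa]
      exact ⟨hn, ha, h⟩

/-- Transfinite recursion along the initial ordinal of `#I`: at each stage fewer than `#I` values
are taken. -/
theorem exists_injective_choice {I α : Type u} (S : I → Set α) (h : ∀ i, #I ≤ #(S i)) :
    ∃ z : I → α, Function.Injective z ∧ ∀ i, z i ∈ S i := by
  obtain ⟨e⟩ : Nonempty ((#I).ord.ToType ≃ I) := Cardinal.eq.1 (by simp)
  have key : ∀ (i : (#I).ord.ToType) (g : Iio i → α), ∃ a ∈ S (e i), a ∉ range g := by
    intro i g
    by_contra! hc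
    have h1 : #(S (e i)) ≤ #(range g) := mk_le_mk_of_subset hc
    have h2 : #(Iio i) < #I := (mk_Iio_lt i (by simp)).trans_eq (by simp)
    exact absurd ((h (e i)).trans (h1.trans mk_range_le)) (not_le.2 h2)
  choose pick hpick hpick' using key
  let z : (#I).ord.ToType → α := wellFounded_lt.fix fun i ih => pick i fun j => ih j.1 j.2
  have hz : ∀ i, z i = pick i fun j => z j.1 := fun i => WellFounded.fix_eq _ _ _
  have hlt : ∀ i j, i < j → z i ≠ z j := by
    intro i j hij heq
    apply hpick' j fun k => z k.1
    rw [← hz j]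
    exact ⟨⟨i, hij⟩, heq⟩
  refine ⟨fun i => z (e.symm i), ?_, fun i => ?_⟩
  · intro i j hij
    rcases lt_trichotomy (e.symm i) (e.symm j) with hl | hl | hl
    · exact absurd hij (hlt _ _ hl)
    · exact e.symm.injective hl
    · exact absurd hij.symm (hlt _ _ hl)
  · have := hpick (e.symm i) fun j => z j.1
    rw [← hz, e.apply_symm_apply] at this
    exact this

/-- Borel sets satisfy the continuum hypothesis: an uncountable one is Borel isomorphic to `ℝ`. -/
theorem mk_eq_continuum_of_measurableSet {α : Type} [MeasurableSpace α] [StandardBorelSpace α]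
    {s : Set α} (hs : MeasurableSet s) (h : ¬ s.Countable) : #s = 𝔠 := by
  have := hs.standardBorel
  rw [← mk_real]
  refine Cardinal.eq.2 ⟨(PolishSpace.measurableEquivOfNotCountable (α := s) (β := ℝ) h ?_).toEquiv⟩
  rw [← mk_le_aleph0_iff, mk_real, not_le]
  exact aleph0_lt_continuum

/-- In a maximal almost disjoint family, a set that meets infinitely many members in an infinite
set meets uncountably many of them in an infinite set. -/
theorem not_countable_of_infinite_inter {α : Type*} {E : α → Set ℕ}
    (hAD : ∀ x y, x ≠ y → (E x ∩ E y).Finite)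
    (hmax : ∀ M : Set ℕ, M.Infinite → ∃ x, (M ∩ E x).Infinite)
    {M : Set ℕ} (hM : {x | (M ∩ E x).Infinite}.Infinite) :
    ¬ {x | (M ∩ E x).Infinite}.Countable := by
  intro hc
  obtain ⟨x, hx⟩ := hc.exists_eq_range hM.nonempty
  -- Diagonalisation: `φ n` lies in `M` but outside the first `n` listed members. By maximality
  -- `range φ` meets some member in an infinite set; that member must be listed, yet each listed one
  -- catches only finitely many `φ n`.
  have key : ∀ n, ∃ᶠ k in atTop, k ∈ M ∧ ∀ i < n, k ∉ E (x i) := by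
    intro n
    obtain ⟨y, hy, hyn⟩ := hM.exists_notMem_finite ((finite_lt_nat n).image x)
    rw [Nat.frequently_atTop_iff_infinite]
    have hfin : (⋃ i ∈ {i | i < n}, E y ∩ E (x i)).Finite :=
      (finite_lt_nat n).biUnion fun i hi => hAD _ _ fun h => hyn ⟨i, hi, h.symm⟩
    refine (hy.sdiff hfin).mono ?_
    rintro k ⟨⟨hkM, hky⟩, hk⟩
    exact ⟨hkM, fun i hi hki => hk (mem_biUnion hi ⟨hky, hki⟩)⟩
  obtain ⟨φ, hφ, hφM⟩ := extraction_forall_of_frequently key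
  obtain ⟨y, hy⟩ := hmax (range φ) (infinite_range_of_injective hφ.injective)
  have hyx : y ∈ {x | (M ∩ E x).Infinite} := by
    refine hy.mono (inter_subset_inter_left _ ?_)
    rintro _ ⟨n, rfl⟩
    exact (hφM n).1
  rw [hx] at hyx
  obtain ⟨i, rfl⟩ := hyx
  refine hy (((finite_Iic i).image φ).subset ?_)
  rintro _ ⟨⟨n, rfl⟩, hn⟩
  refine ⟨n, ?_, rfl⟩
  by_contra hni
  exact (hφM n).2 i (not_le.1 hni) hn

/-- The points of the Cantor space along whose branch `f` has a limit lying in `s`. -/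
def branchLimitSet (f : ℕ → ℝ) (s : Set ℝ) : Set (ℕ → Bool) :=
  {x | ∃ l ∈ s, Tendsto (fun n => f (branchCode x n)) atTop (𝓝 l)}

/-- A Mrówka family: an almost disjoint family of size continuum such that every function
converging along all members has essentially just one limit. -/
theorem exists_mrowka_family :
    ∃ (J : Type) (A : J → Set ℕ), #J = 𝔠 ∧ (∀ j, (A j).Infinite) ∧
      (∀ i j, i ≠ j → (A i ∩ A j).Finite) ∧ (∀ M : Set ℕ, M.Infinite → ∃ j, (M ∩ A j).Infinite) ∧
      ∀ (f : ℕ → ℝ) (l : J → ℝ), (∀ j, Tendsto f (cofinite ⊓ 𝓟 (A j)) (𝓝 (l j))) →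
        ∀ r s, r < s → {j | l j ≤ r}.Finite ∨ {j | s ≤ l j}.Finite := by
  obtain ⟨E, hRE, hAD, hmax⟩ := exists_almostDisjoint_branches
  let I : Type := {p : (ℕ → ℝ) × ℝ × ℝ //
    #(branchLimitSet p.1 (Iic p.2.1)) = 𝔠 ∧ #(branchLimitSet p.1 (Ici p.2.2)) = 𝔠}
  have hI : #(I × Bool) ≤ 𝔠 := by
    have h1 : #I ≤ 𝔠 := (mk_subtype_le _).trans (by simp [mk_real])
    rw [mk_prod]
    simp only [lift_id, mk_fintype, Fintype.card_bool]
    calc #I * _ ≤ 𝔠 * 𝔠 := mul_le_mul' h1 (nat_lt_continuum 2).le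
      _ = 𝔠 := continuum_mul_self
  obtain ⟨z, hz, hzS⟩ := exists_injective_choice
    (fun p : I × Bool => if p.2 then branchLimitSet p.1.1.1 (Ici p.1.1.2.2)
      else branchLimitSet p.1.1.1 (Iic p.1.1.2.1)) (by
        rintro ⟨i, b⟩
        cases b
        · simpa [i.2.1] using hI
        · simpa [i.2.2] using hI)
  let w : I → ℕ → Bool := fun i => z (i, true)
  have hw : Function.Injective w := fun i j h => by simpa using hz h
  -- `q` sends `z (i, true)` to its partner `z (i, false)` and fixes all else; members with equal
  -- `q` are glued.
  let q : (ℕ → Bool) → ℕ → Bool := Function.extend w (fun i => z (i, false)) id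
  have hqw : ∀ i, q (z (i, true)) = z (i, false) := fun i => hw.extend_apply _ _ i
  have hq' : ∀ x, x ∉ range w → q x = x := fun x hx => Function.extend_apply' _ _ _ hx
  have hqf : ∀ i, q (z (i, false)) = z (i, false) := by
    refine fun i => hq' _ ?_
    rintro ⟨j, hj⟩
    simpa using hz hj
  have hfib : ∀ y, {x | q x = y}.Finite := by
    intro y
    have hsub : {x | x ∈ range w ∧ q x = y}.Subsingleton := by
      rintro _ ⟨⟨i, rfl⟩, hi⟩ _ ⟨⟨j, rfl⟩, hj⟩
      have : z (i, false) = z (j, false) := by rw [← hqw, ← hqw]; exact hi.trans hj.symm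
      have : i = j := by simpa using hz this
      rw [this]
    refine (hsub.finite.union (finite_singleton y)).subset fun x hx => ?_
    by_cases h : x ∈ range w
    · exact Or.inl ⟨h, hx⟩
    · exact Or.inr (by rw [← hq' x h]; exact hx)
  let Q : (ℕ → Bool) → range q := rangeFactorization q
  let A : range q → Set ℕ := fun j => ⋃ x ∈ {x | q x = j}, E x
  have hEA : ∀ x, E x ⊆ A (Q x) := fun x => subset_biUnion_of_mem (u := E) (x := x) rfl
  have hRinf : ∀ x, (E x).Infinite := fun x =>
    (infinite_range_of_injective (branchCode_injective x)).mono (hRE x)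
  have hcard : #(range q) = 𝔠 := by
    have hC : #(ℕ → Bool) = 𝔠 := by simp
    refine le_antisymm (hC ▸ mk_set_le _) ?_
    classical
    -- The value of `q` and one bit determine `x`, so gluing does not lower the cardinality.
    have hinj : Function.Injective fun x => (Q x, decide (x ∈ range w)) := by
      intro x y hxy
      simp only [Prod.mk.injEq, decide_eq_decide] at hxy
      obtain ⟨h1, h2⟩ := hxy
      have h1 : q x = q y := congrArg Subtype.val h1
      by_cases hx : x ∈ range w
      · obtain ⟨j, rfl⟩ := h2.1 hx
        obtain ⟨i, rfl⟩ := hx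
        have : z (i, false) = z (j, false) := by rw [← hqw, ← hqw]; exact h1
        have : i = j := by simpa using hz this
        rw [this]
      · rw [← hq' x hx, h1, hq' y fun hy => hx (h2.2 hy)]
    have h1 := mk_le_of_injective hinj
    rw [hC, mk_prod] at h1
    simp only [lift_id, mk_fintype, Fintype.card_bool] at h1
    by_contra! hlt
    exact absurd h1 (not_le.2 (mul_lt_of_lt aleph0_le_continuum hlt (nat_lt_continuum 2)))
  refine ⟨range q, A, hcard, fun j => ?_, fun i j hij => ?_, fun M hM => ?_, fun f l hl r s hrs => ?_⟩
  · obtain ⟨x, rfl⟩ := rangeFactorization_surjective (f := q) j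
    exact (hRinf x).mono (hEA x)
  · simp only [A, iUnion_inter, inter_iUnion]
    refine (hfib j).biUnion fun y hy => (hfib i).biUnion fun x hx => hAD _ _ ?_
    rintro rfl
    exact hij (Subtype.ext (hx.symm.trans hy))
  · obtain ⟨x, hx⟩ := hmax M hM
    exact ⟨Q x, hx.mono (inter_subset_inter_right _ (hEA x))⟩
  · have hbr : ∀ x, Tendsto (fun n => f (branchCode x n)) atTop (𝓝 (l (Q x))) := by
      intro x
      refine (hl (Q x)).comp (tendsto_inf.2 ⟨?_, ?_⟩)
      · rw [← Nat.cofinite_eq_atTop]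
        exact (branchCode_injective x).tendsto_cofinite
      · exact tendsto_principal.2 (Eventually.of_forall fun n => hEA x (hRE x ⟨n, rfl⟩))
    have hmeas : Measurable fun x => l (Q x) :=
      measurable_of_tendsto_metrizable (fun n => (continuous_comp_branchCode f n).measurable)
        (tendsto_pi_nhds.2 hbr)
    have hset : ∀ t : Set ℝ, branchLimitSet f t = {x | l (Q x) ∈ t} := by
      intro t
      ext x
      constructor
      · rintro ⟨a, ha, hta⟩
        rwa [tendsto_nhds_unique hta (hbr x)] at ha
      · intro h
        exact ⟨_, h, hbr x⟩
    have hlim : ∀ (t : Set ℝ) (M : Set ℕ), IsClosed t → (∀ k ∈ M, f k ∈ t) →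
        ∀ x, (M ∩ E x).Infinite → l (Q x) ∈ t := by
      intro t M ht hMt x hx
      have hfr : ∃ᶠ k in cofinite ⊓ 𝓟 (A (Q x)), f k ∈ t := by
        rw [frequently_inf_principal, frequently_cofinite_iff_infinite]
        refine hx.mono ?_
        rintro k ⟨hk, hkx⟩
        exact ⟨hEA x hkx, hMt k hk⟩
      exact ht.mem_of_frequently_of_tendsto hfr (hl (Q x))
    -- Infinitely many limits in `o` make `f ⁻¹' o` meet infinitely many, hence uncountably many, of
    -- the `E x` in infinite sets; all of these have limit in `t`, and the set of such `x` is Borel.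
    have hbig : ∀ (o t : Set ℝ), IsOpen o → IsClosed t → o ⊆ t → {j | l j ∈ o}.Infinite →
        #(branchLimitSet f t) = 𝔠 := by
      intro o t ho ht hot hinf
      rw [hset]
      refine mk_eq_continuum_of_measurableSet (hmeas ht.measurableSet) fun hc => ?_
      have hMinf : {x | ({k | f k ∈ o} ∩ E x).Infinite}.Infinite := by
        intro hfin
        refine hinf ((hfin.image Q).subset fun j hj => ?_)
        obtain ⟨x, rfl⟩ := rangeFactorization_surjective (f := q) j
        refine ⟨x, ?_, rfl⟩
        have hev : ∀ᶠ k in cofinite ⊓ 𝓟 (A (Q x)), f k ∈ o := hl (Q x) (ho.mem_nhds hj)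
        rw [eventually_inf_principal, eventually_cofinite] at hev
        refine ((hRinf x).sdiff hev).mono ?_
        rintro k ⟨hk, hk'⟩
        simp only [mem_ofPred_eq, not_not] at hk'
        exact ⟨hk' (hEA x hk), hk⟩
      exact not_countable_of_infinite_inter hAD hmax hMinf
        (hc.mono fun x hx => hlim t _ ht (fun k hk => hot hk) x hx)
    by_contra! hcon
    -- With `r < r' < s' < s`, both infinite sets of limits enter open half-lines whose closures are
    -- still disjoint.
    obtain ⟨r', hr, hr's⟩ := exists_between hrs
    obtain ⟨s', hrs', hs⟩ := exists_between hr's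
    have h1 := hbig (Iio r') (Iic r') isOpen_Iio isClosed_Iic Iio_subset_Iic_self
      ((not_finite.1 hcon.1).mono fun j hj => lt_of_le_of_lt hj hr)
    have h2 := hbig (Ioi s') (Ici s') isOpen_Ioi isClosed_Ici Ioi_subset_Ici_self
      ((not_finite.1 hcon.2).mono fun j hj => lt_of_lt_of_le hs hj)
    let i : I := ⟨(f, r', s'), h1, h2⟩
    have ha : z (i, false) ∈ branchLimitSet f (Iic r') := by simpa using hzS (i, false)
    have hb : z (i, true) ∈ branchLimitSet f (Ici s') := by simpa using hzS (i, true)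
    rw [hset] at ha hb
    have hQ : Q (z (i, true)) = Q (z (i, false)) := Subtype.ext ((hqw i).trans (hqf i).symm)
    simp only [mem_ofPred_eq, mem_Iic, mem_Ici, hQ] at ha hb
    linarith

/-! ### Homogeneity from clopen Cantor sets -/

theorem exists_homeomorph_cantor (a b : ℕ → Bool) : ∃ h : (ℕ → Bool) ≃ₜ (ℕ → Bool), h a = b := by
  let φ : (ℕ → Bool) → ℕ → Bool := fun c i => xor (c i) (xor (a i) (b i))
  have hφ : Function.Involutive φ := by
    intro c
    funext i
    simp [φ]
  have hc : Continuous φ := continuous_pi fun i =>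
    (continuous_of_discreteTopology (f := fun t => xor t (xor (a i) (b i)))).comp
      (continuous_apply i)
  refine ⟨⟨hφ.toPerm, hc, hc⟩, ?_⟩
  funext i
  change xor (a i) (xor (a i) (b i)) = b i
  rw [← Bool.xor_assoc, Bool.xor_self, Bool.false_xor]

theorem exists_homeomorph_swap {X C : Type*} [TopologicalSpace X] [TopologicalSpace C]
    {i k : C → X} (hi : IsOpenEmbedding i) (hk : IsOpenEmbedding k) (hic : IsClosed (range i))
    (hkc : IsClosed (range k)) (hd : Disjoint (range i) (range k)) :
    ∃ h : X ≃ₜ X, ∀ a, h (i a) = k a := by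
  let φ : X → X := Function.extend i k (Function.extend k i id)
  have h1 : ∀ a, φ (i a) = k a := fun a => hi.injective.extend_apply _ _ a
  have h2' : ∀ x, x ∉ range i → φ x = Function.extend k i id x :=
    fun x hx => Function.extend_apply' _ _ _ hx
  have h2 : ∀ a, φ (k a) = i a := fun a => by
    rw [h2' _ (disjoint_right.1 hd ⟨a, rfl⟩), hk.injective.extend_apply]
  have h3 : ∀ x, x ∉ range i → x ∉ range k → φ x = x := fun x hx hx' => by
    rw [h2' x hx, Function.extend_apply' _ _ _ hx', id]
  have hφ : Function.Involutive φ := by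
    intro x
    by_cases hx : x ∈ range i
    · obtain ⟨a, rfl⟩ := hx
      rw [h1, h2]
    · by_cases hx' : x ∈ range k
      · obtain ⟨a, rfl⟩ := hx'
        rw [h2, h1]
      · rw [h3 x hx hx', h3 x hx hx']
  have hc : Continuous φ := by
    rw [continuous_iff_continuousAt]
    intro x
    by_cases hx : x ∈ range i
    · obtain ⟨a, rfl⟩ := hx
      rw [← hi.continuousAt_iff, show φ ∘ i = k from funext h1]
      exact hk.continuous.continuousAt
    · by_cases hx' : x ∈ range k
      · obtain ⟨a, rfl⟩ := hx'
        rw [← hk.continuousAt_iff, show φ ∘ k = i from funext h2]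
        exact hi.continuous.continuousAt
      · refine continuousAt_id.congr ?_
        filter_upwards [hic.isOpen_compl.mem_nhds hx, hkc.isOpen_compl.mem_nhds hx'] with y hy hy'
        exact (h3 y hy hy').symm
  exact ⟨⟨hφ.toPerm, hc, hc⟩, h1⟩

/-- A Hausdorff space covered by open copies of the Cantor space is completely regular. -/
theorem t35Space_of_cantor_cover {X ι : Type*} [TopologicalSpace X] [T2Space X]
    (e : ι → (ℕ → Bool) → X) (he : ∀ i, IsOpenEmbedding (e i)) (hcov : ∀ x, ∃ i, x ∈ range (e i)) :
    T35Space X := by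
  have hbasis : TopologicalSpace.IsTopologicalBasis {s : Set X | IsClopen s} := by
    refine TopologicalSpace.isTopologicalBasis_of_isOpen_of_nhds (fun s hs => hs.isOpen) ?_
    intro x U hx hU
    obtain ⟨i, a, rfl⟩ := hcov x
    obtain ⟨W, hW, haW, hWU⟩ :=
      compact_exists_isClopen_in_isOpen (hU.preimage (he i).continuous) hx
    refine ⟨e i '' W, ⟨?_, (he i).isOpenMap _ hW.isOpen⟩, ⟨a, haW, rfl⟩, image_subset_iff.2 hWU⟩
    exact (hW.isClosed.isCompact.image (he i).continuous).isClosed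
  have := CompletelyRegularSpace.of_isTopologicalBasis_clopens hbasis
  exact {}

/-- The detour through `z` is needed when `x = y`, where no disjoint pair of pieces separates the
two points. -/
theorem isHomogeneousSpace_of_cantor_pieces {X : Type*} [TopologicalSpace X] [T2Space X]
    (hX : ∀ x y : X, ∃ z, (x = z ∨ ∃ i k : (ℕ → Bool) → X, IsOpenEmbedding i ∧ IsOpenEmbedding k ∧
      Disjoint (range i) (range k) ∧ x ∈ range i ∧ z ∈ range k) ∧
      ∃ i k : (ℕ → Bool) → X, IsOpenEmbedding i ∧ IsOpenEmbedding k ∧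
        Disjoint (range i) (range k) ∧ z ∈ range i ∧ y ∈ range k) :
    IsHomogeneousSpace X := by
  have key : ∀ x z : X, (∃ i k : (ℕ → Bool) → X, IsOpenEmbedding i ∧ IsOpenEmbedding k ∧
      Disjoint (range i) (range k) ∧ x ∈ range i ∧ z ∈ range k) → ∃ h : X ≃ₜ X, h x = z := by
    rintro _ _ ⟨i, k, hi, hk, hd, ⟨a, rfl⟩, ⟨b, rfl⟩⟩
    obtain ⟨g, rfl⟩ := exists_homeomorph_cantor a b
    have hr : range (k ∘ g) = range k := g.surjective.range_comp k
    obtain ⟨h, hh⟩ := exists_homeomorph_swap hi (hk.comp g.isOpenEmbedding)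
      (isCompact_range hi.continuous).isClosed
      (isCompact_range (hk.comp g.isOpenEmbedding).continuous).isClosed (by rwa [hr])
    exact ⟨h, hh a⟩
  intro x y
  obtain ⟨z, h1, h2⟩ := hX x y
  obtain ⟨g, rfl⟩ := key _ _ h2
  rcases h1 with rfl | h1
  · exact ⟨g, rfl⟩
  · obtain ⟨h, rfl⟩ := key _ _ h1
    exact ⟨h.trans g, rfl⟩

/-! ### The Ψ-space with Cantor blocks -/

/-- The points of the space obtained from the `Ψ`-space of `A` by replacing each isolated point
with a Cantor space. -/
def CantorPsi {J : Type} (_ : J → Set ℕ) : Type := ℕ × (ℕ → Bool) ⊕ J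

namespace CantorPsi

variable {J : Type} {A : J → Set ℕ}

def block (p : ℕ × (ℕ → Bool)) : CantorPsi A := Sum.inl p

def limit (j : J) : CantorPsi A := Sum.inr j

theorem block_injective : Function.Injective (block : _ → CantorPsi A) := Sum.inl_injective

theorem limit_injective : Function.Injective (limit : _ → CantorPsi A) := Sum.inr_injective

theorem block_ne_limit (p : ℕ × (ℕ → Bool)) (j : J) : (block p : CantorPsi A) ≠ limit j :=
  Sum.inl_ne_inr

theorem cases (x : CantorPsi A) : (∃ p, x = block p) ∨ ∃ j, x = limit j := by
  rcases x with p | j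
  exacts [Or.inl ⟨p, rfl⟩, Or.inr ⟨j, rfl⟩]

/-- Since whole blocks are absorbed, a limit point together with the blocks of an infinite `A j`
compactifies a countable sum of Cantor sets by one point, which is again a Cantor set. -/
instance : TopologicalSpace (CantorPsi A) where
  IsOpen U := IsOpen {p | block p ∈ U} ∧
    ∀ j, limit j ∈ U → ∀ᶠ n in cofinite, n ∈ A j → ∀ c, block (n, c) ∈ U
  isOpen_univ := ⟨by simp, fun j _ => by simp⟩
  isOpen_inter U V hU hV := ⟨hU.1.inter hV.1, fun j hj => by
    filter_upwards [hU.2 j hj.1, hV.2 j hj.2] with n h1 h2 hn c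
    exact ⟨h1 hn c, h2 hn c⟩⟩
  isOpen_sUnion S hS := by
    refine ⟨?_, ?_⟩
    · have : {p | (block p : CantorPsi A) ∈ ⋃₀ S} = ⋃ U ∈ S, {p | block p ∈ U} := by
        ext p
        simp
      rw [this]
      exact isOpen_biUnion fun U hU => (hS U hU).1
    · rintro j ⟨U, hU, hj⟩
      filter_upwards [(hS U hU).2 j hj] with n h hn c
      exact ⟨U, hU, h hn c⟩

theorem isOpen_iff {U : Set (CantorPsi A)} : IsOpen U ↔ IsOpen {p | block p ∈ U} ∧
    ∀ j, limit j ∈ U → ∀ᶠ n in cofinite, n ∈ A j → ∀ c, block (n, c) ∈ U := Iff.rfl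

theorem continuous_block : Continuous (block : _ → CantorPsi A) :=
  continuous_def.2 fun _ hU => hU.1

theorem isOpen_image_block {s : Set (ℕ × (ℕ → Bool))} (hs : IsOpen s) :
    IsOpen (block '' s : Set (CantorPsi A)) := by
  refine isOpen_iff.2 ⟨?_, ?_⟩
  · have : {p | block p ∈ (block '' s : Set (CantorPsi A))} = s :=
      preimage_image_eq s block_injective
    rwa [this]
  · rintro j ⟨p, _, hp⟩
    exact absurd hp (block_ne_limit p j)

/-- The basic neighbourhood of a limit point determined by a set of blocks. -/
def nbhd (B : Set ℕ) (j : J) : Set (CantorPsi A) :=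
  insert (limit j) (block '' {p | p.1 ∈ B})

theorem block_mem_nbhd {B : Set ℕ} {j : J} {p : ℕ × (ℕ → Bool)} :
    (block p : CantorPsi A) ∈ nbhd B j ↔ p.1 ∈ B := by
  unfold nbhd
  rw [mem_insert_iff, block_injective.mem_set_image]
  simp [block_ne_limit]

theorem limit_mem_nbhd {B : Set ℕ} {i j : J} :
    (limit i : CantorPsi A) ∈ nbhd B j ↔ i = j := by
  unfold nbhd
  rw [mem_insert_iff, limit_injective.eq_iff, or_iff_left]
  rintro ⟨p, _, hp⟩
  exact block_ne_limit p i hp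

theorem isOpen_nbhd {B : Set ℕ} {j : J} (hB : (A j \ B).Finite) :
    IsOpen (nbhd B j : Set (CantorPsi A)) := by
  refine isOpen_iff.2 ⟨?_, ?_⟩
  · simp only [block_mem_nbhd]
    exact (isOpen_discrete B).preimage continuous_fst
  · intro i hi
    obtain rfl := limit_mem_nbhd.1 hi
    filter_upwards [hB.compl_mem_cofinite] with n hn hnA c
    rw [block_mem_nbhd]
    by_contra h
    exact hn ⟨hnA, h⟩

theorem t2Space (hA : ∀ i j, i ≠ j → (A i ∩ A j).Finite) : T2Space (CantorPsi A) := by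
  have hbl : ∀ (p : ℕ × (ℕ → Bool)) (j : J), ∃ u v : Set (CantorPsi A), IsOpen u ∧ IsOpen v ∧
      block p ∈ u ∧ limit j ∈ v ∧ Disjoint u v := by
    intro p j
    refine ⟨block '' {r | r.1 = p.1}, nbhd {p.1}ᶜ j,
      isOpen_image_block ((isOpen_discrete {p.1}).preimage continuous_fst),
      isOpen_nbhd ((finite_singleton p.1).subset fun n hn => by simpa using hn.2),
      ⟨p, rfl, rfl⟩, limit_mem_nbhd.2 rfl, ?_⟩
    rw [Set.disjoint_left]
    rintro _ ⟨r, hr, rfl⟩ h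
    exact block_mem_nbhd.1 h hr
  refine ⟨fun x y hxy => ?_⟩
  rcases cases x with ⟨p, rfl⟩ | ⟨i, rfl⟩ <;> rcases cases y with ⟨r, rfl⟩ | ⟨j, rfl⟩
  · obtain ⟨u, v, hu, hv, hp, hr, hd⟩ := t2_separation (ne_of_apply_ne block hxy)
    exact ⟨_, _, isOpen_image_block hu, isOpen_image_block hv, mem_image_of_mem _ hp,
      mem_image_of_mem _ hr, (disjoint_image_iff block_injective).2 hd⟩
  · exact hbl p j
  · obtain ⟨u, v, hu, hv, h1, h2, hd⟩ := hbl r i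
    exact ⟨v, u, hv, hu, h2, h1, hd.symm⟩
  · have hij : i ≠ j := ne_of_apply_ne _ hxy
    refine ⟨nbhd (A i \ A j) i, nbhd (A j) j, isOpen_nbhd ?_, isOpen_nbhd (by simp),
      limit_mem_nbhd.2 rfl, limit_mem_nbhd.2 rfl, ?_⟩
    · rw [sdiff_sdiff_right_self]
      exact hA i j hij
    · rw [Set.disjoint_left]
      intro x hx hx'
      rcases cases x with ⟨p, rfl⟩ | ⟨k, rfl⟩
      · exact (block_mem_nbhd.1 hx).2 (block_mem_nbhd.1 hx')
      · exact hij ((limit_mem_nbhd.1 hx).symm.trans (limit_mem_nbhd.1 hx'))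

open Classical in
/-- The copy of the Cantor space formed by a limit point and the blocks enumerated by `a`. -/
noncomputable def spike (a : ℕ → ℕ) (j : J) (c : ℕ → Bool) : CantorPsi A :=
  -- The position of the first `true` selects the block; the coordinates after it, hence the `+ 1`,
  -- give the point.
  if h : ∃ k, c k = true then block (a (Nat.find h), fun i => c (Nat.find h + 1 + i)) else limit j

theorem spike_of_forall {a : ℕ → ℕ} {j : J} {c : ℕ → Bool} (h : ∀ k, c k = false) :
    (spike a j c : CantorPsi A) = limit j := by
  unfold spike
  rw [dif_neg]
  simp [h]

theorem spike_of_first {a : ℕ → ℕ} {j : J} {c : ℕ → Bool} {k : ℕ} (hk : c k = true)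
    (h : ∀ i < k, c i = false) :
    (spike a j c : CantorPsi A) = block (a k, fun i => c (k + 1 + i)) := by
  classical
  have hex : ∃ k, c k = true := ⟨k, hk⟩
  have hf : Nat.find hex = k := (Nat.find_eq_iff hex).2 ⟨hk, fun i hi => by simp [h i hi]⟩
  unfold spike
  rw [dif_pos hex]
  congr 2
  · convert congrArg a hf
  · funext i
    congr 2
    convert congrArg (· + 1) hf

theorem exists_first (c : ℕ → Bool) :
    (∀ k, c k = false) ∨ ∃ k, c k = true ∧ ∀ i < k, c i = false := by
  by_cases h : ∃ k, c k = true
  · right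
    exact ⟨Nat.find h, Nat.find_spec h, fun i hi => by simpa using Nat.find_min h hi⟩
  · left
    simpa using h

theorem spike_injective {a : ℕ → ℕ} (ha : Function.Injective a) (j : J) :
    Function.Injective (spike a j : _ → CantorPsi A) := by
  intro c d hcd
  rcases exists_first c with hc | ⟨k, hk, hc⟩ <;> rcases exists_first d with hd | ⟨m, hm, hd⟩
  · funext i
    rw [hc, hd]
  · rw [spike_of_forall hc, spike_of_first hm hd] at hcd
    exact absurd hcd.symm (block_ne_limit _ _)
  · rw [spike_of_first hk hc, spike_of_forall hd] at hcd
    exact absurd hcd (block_ne_limit _ _)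
  · rw [spike_of_first hk hc, spike_of_first hm hd] at hcd
    obtain ⟨h1, h2⟩ := Prod.mk.inj (block_injective hcd)
    obtain rfl := ha h1
    funext i
    rcases lt_trichotomy i k with h | rfl | h
    · rw [hc i h, hd i h]
    · rw [hk, hm]
    · obtain ⟨b, rfl⟩ := Nat.exists_eq_add_of_le (Nat.succ_le_of_lt h)
      exact congrFun h2 b

theorem range_spike (a : ℕ → ℕ) (j : J) :
    range (spike a j : _ → CantorPsi A) = nbhd (range a) j := by
  ext x
  constructor
  · rintro ⟨c, rfl⟩
    rcases exists_first c with hc | ⟨k, hk, hc⟩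
    · rw [spike_of_forall hc]
      exact limit_mem_nbhd.2 rfl
    · rw [spike_of_first hk hc]
      exact block_mem_nbhd.2 ⟨k, rfl⟩
  · intro hx
    rcases cases x with ⟨⟨n, d⟩, rfl⟩ | ⟨i, rfl⟩
    · obtain ⟨k, rfl⟩ := block_mem_nbhd.1 hx
      refine ⟨fun i => if i < k then false else if i = k then true else d (i - (k + 1)), ?_⟩
      rw [spike_of_first (k := k) (by simp) (fun i hi => by simp [hi])]
      congr 2
      funext i
      rw [if_neg (by omega), if_neg (by omega)]
      congr 1
      omega
    · obtain rfl := limit_mem_nbhd.1 hx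
      exact ⟨fun _ => false, spike_of_forall fun _ => rfl⟩

theorem continuous_spike {a : ℕ → ℕ} (ha : Function.Injective a) {j : J} (haA : range a ⊆ A j) :
    Continuous (spike a j : _ → CantorPsi A) := by
  rw [continuous_iff_continuousAt]
  intro c
  rcases exists_first c with hc | ⟨k, hk, hc⟩
  · rw [ContinuousAt, spike_of_forall hc, (nhds_basis_opens _).tendsto_right_iff]
    rintro U ⟨hj, hU⟩
    have h1 := ha.tendsto_cofinite.eventually (hU.2 j hj)
    rw [Nat.cofinite_eq_atTop, eventually_atTop] at h1
    obtain ⟨N, hN⟩ := h1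
    filter_upwards [eventually_eq_below c N] with d hd
    rcases exists_first d with h | ⟨m, hm, h⟩
    · rwa [spike_of_forall h]
    · rw [spike_of_first hm h]
      refine hN m ?_ (haA ⟨m, rfl⟩) _
      by_contra hmN
      have := hd m (not_le.1 hmN)
      rw [hm, hc] at this
      exact Bool.noConfusion this
  · have hcont : Continuous fun d : ℕ → Bool =>
        (block (a k, fun i => d (k + 1 + i)) : CantorPsi A) :=
      continuous_block.comp (continuous_const.prodMk
        (continuous_pi fun i => continuous_apply (k + 1 + i)))
    refine hcont.continuousAt.congr ?_
    filter_upwards [eventually_eq_below c (k + 1)] with d hd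
    rw [spike_of_first ((hd k (Nat.lt_succ_self k)).trans hk)
      fun i hi => (hd i (by omega)).trans (hc i hi)]

theorem isOpenEmbedding_spike [T2Space (CantorPsi A)] {a : ℕ → ℕ} (ha : Function.Injective a)
    {j : J} (haA : range a ⊆ A j) (hfin : (A j \ range a).Finite) :
    IsOpenEmbedding (spike a j : _ → CantorPsi A) := by
  refine ⟨((continuous_spike ha haA).isClosedEmbedding (spike_injective ha j)).isEmbedding, ?_⟩
  rw [range_spike]
  exact isOpen_nbhd hfin

/-- The copies of the Cantor space that cover the space. -/
noncomputable def piece (A : J → Set ℕ) : ℕ ⊕ J → (ℕ → Bool) → CantorPsi A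
  | Sum.inl n => fun c => block (n, c)
  | Sum.inr j => spike (Nat.nth (· ∈ A j)) j

theorem range_piece_inl (n : ℕ) : range (piece A (Sum.inl n)) = block '' {p | p.1 = n} := by
  ext x
  constructor
  · rintro ⟨c, rfl⟩
    exact ⟨(n, c), rfl, rfl⟩
  · rintro ⟨⟨_, c⟩, rfl, rfl⟩
    exact ⟨c, rfl⟩

theorem isOpenEmbedding_piece_inl [T2Space (CantorPsi A)] (n : ℕ) :
    IsOpenEmbedding (piece A (Sum.inl n)) := by
  have hc : Continuous (piece A (Sum.inl n)) := continuous_block.comp (by fun_prop)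
  refine ⟨(hc.isClosedEmbedding fun c d h => (Prod.mk.inj (block_injective h)).2).isEmbedding, ?_⟩
  rw [range_piece_inl]
  exact isOpen_image_block ((isOpen_discrete {n}).preimage continuous_fst)

theorem range_piece_inr (hinf : ∀ j, (A j).Infinite) (j : J) :
    range (piece A (Sum.inr j)) = nbhd (A j) j := by
  change range (spike _ j) = _
  rw [range_spike]
  congr 1
  exact Nat.range_nth_of_infinite (hinf j)

theorem exists_isOpenEmbedding_nbhd [T2Space (CantorPsi A)] {B : Set ℕ} {j : J}
    (hB : B.Infinite) (hBA : B ⊆ A j) (hfin : (A j \ B).Finite) :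
    ∃ i : (ℕ → Bool) → CantorPsi A, IsOpenEmbedding i ∧ range i = nbhd B j := by
  have hr : range (Nat.nth (· ∈ B)) = B := Nat.range_nth_of_infinite hB
  refine ⟨spike (Nat.nth (· ∈ B)) j, isOpenEmbedding_spike (Nat.nth_injective (p := (· ∈ B)) hB) ?_ ?_, ?_⟩
  · rwa [hr]
  · rwa [hr]
  · rw [range_spike, hr]

theorem isOpenEmbedding_piece [T2Space (CantorPsi A)] (hinf : ∀ j, (A j).Infinite) :
    ∀ t, IsOpenEmbedding (piece A t)
  | Sum.inl n => isOpenEmbedding_piece_inl n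
  | Sum.inr j => by
    have hr : range (Nat.nth (· ∈ A j)) = A j := Nat.range_nth_of_infinite (hinf j)
    exact isOpenEmbedding_spike (Nat.nth_injective (p := (· ∈ A j)) (hinf j)) hr.subset (by simp [hr])

theorem exists_mem_range_piece (hinf : ∀ j, (A j).Infinite) (x : CantorPsi A) :
    ∃ t, x ∈ range (piece A t) := by
  rcases cases x with ⟨⟨n, c⟩, rfl⟩ | ⟨j, rfl⟩
  · exact ⟨Sum.inl n, c, rfl⟩
  · refine ⟨Sum.inr j, ?_⟩
    rw [range_piece_inr hinf]
    exact limit_mem_nbhd.2 rfl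

theorem limit_mem_range_piece (hinf : ∀ j, (A j).Infinite) {j : J} {t : ℕ ⊕ J} :
    limit j ∈ range (piece A t) ↔ t = Sum.inr j := by
  rcases t with n | i
  · rw [range_piece_inl]
    refine ⟨?_, fun h => by simp at h⟩
    rintro ⟨p, _, hp⟩
    exact absurd hp (block_ne_limit p j)
  · rw [range_piece_inr hinf, limit_mem_nbhd, Sum.inr.injEq, eq_comm]

theorem isHomogeneousSpace (hinf : ∀ j, (A j).Infinite)
    (hA : ∀ i j, i ≠ j → (A i ∩ A j).Finite) : IsHomogeneousSpace (CantorPsi A) := by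
  have := t2Space hA
  let P : CantorPsi A → CantorPsi A → Prop := fun x y => ∃ i k : (ℕ → Bool) → CantorPsi A,
    IsOpenEmbedding i ∧ IsOpenEmbedding k ∧ Disjoint (range i) (range k) ∧
      x ∈ range i ∧ y ∈ range k
  have hsymm : ∀ x y, P x y → P y x := by
    rintro x y ⟨i, k, hi, hk, hd, hx, hy⟩
    exact ⟨k, i, hk, hi, hd.symm, hy, hx⟩
  have hbb : ∀ n m c d, n ≠ m → P (block (n, c)) (block (m, d)) := by
    intro n m c d hnm
    refine ⟨piece A (Sum.inl n), piece A (Sum.inl m), isOpenEmbedding_piece hinf _,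
      isOpenEmbedding_piece hinf _, ?_, ⟨c, rfl⟩, ⟨d, rfl⟩⟩
    rw [Set.disjoint_left]
    rintro _ ⟨c', rfl⟩ ⟨d', hd'⟩
    exact hnm (Prod.mk.inj (block_injective hd')).1.symm
  have hbl : ∀ p j, P (block p) (limit j) := by
    intro p j
    have hfin : (A j \ (A j \ {p.1})).Finite := by
      rw [sdiff_sdiff_right_self]
      exact (finite_singleton p.1).subset inter_subset_right
    obtain ⟨i, hi, hri⟩ := exists_isOpenEmbedding_nbhd (A := A)
      ((hinf j).sdiff (finite_singleton p.1)) sdiff_subset hfin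
    refine ⟨piece A (Sum.inl p.1), i, isOpenEmbedding_piece hinf _, hi, ?_, ⟨p.2, rfl⟩, ?_⟩
    · rw [hri, Set.disjoint_left]
      rintro _ ⟨c', rfl⟩ h
      exact (block_mem_nbhd.1 h).2 rfl
    · rw [hri]
      exact limit_mem_nbhd.2 rfl
  have hll : ∀ i j, i ≠ j → P (limit i) (limit j) := by
    intro i j hij
    have hfin : (A i \ (A i \ A j)).Finite := by
      rw [sdiff_sdiff_right_self]
      exact hA i j hij
    have hinf' : (A i \ A j).Infinite := by
      rw [← sdiff_self_inter]
      exact (hinf i).sdiff (hA i j hij)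
    obtain ⟨f, hf, hrf⟩ := exists_isOpenEmbedding_nbhd (A := A) hinf' sdiff_subset hfin
    refine ⟨f, piece A (Sum.inr j), hf, isOpenEmbedding_piece hinf _, ?_, ?_, ?_⟩
    · rw [hrf, range_piece_inr hinf, Set.disjoint_left]
      intro x hx hx'
      rcases cases x with ⟨p, rfl⟩ | ⟨k, rfl⟩
      · exact (block_mem_nbhd.1 hx).2 (block_mem_nbhd.1 hx')
      · exact hij ((limit_mem_nbhd.1 hx).symm.trans (limit_mem_nbhd.1 hx'))
    · rw [hrf]
      exact limit_mem_nbhd.2 rfl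
    · exact (limit_mem_range_piece hinf).2 rfl
  refine isHomogeneousSpace_of_cantor_pieces fun x y => ?_
  rcases cases x with ⟨⟨n, c⟩, rfl⟩ | ⟨i, rfl⟩ <;> rcases cases y with ⟨⟨m, d⟩, rfl⟩ | ⟨j, rfl⟩
  -- The index `n + m + 1` differs from both `n` and `m`, which may coincide.
  · exact ⟨block (n + m + 1, c), Or.inr (hbb _ _ _ _ (by omega)), hbb _ _ _ _ (by omega)⟩
  · exact ⟨_, Or.inl rfl, hbl _ _⟩
  · exact ⟨_, Or.inl rfl, hsymm _ _ (hbl _ _)⟩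
  · exact ⟨block (0, fun _ => false), Or.inr (hsymm _ _ (hbl _ _)), hbl _ _⟩

/-- Upper bound: countable bases of `𝔠` open pieces. Lower bound: the limit points form a discrete
subspace of size `𝔠`. -/
theorem topWeight_eq (hJ : #J = 𝔠) (hinf : ∀ j, (A j).Infinite)
    (hA : ∀ i j, i ≠ j → (A i ∩ A j).Finite) : topWeight (CantorPsi A) = 𝔠 := by
  have := t2Space hA
  have he := isOpenEmbedding_piece hinf
  apply le_antisymm
  · let β := TopologicalSpace.countableBasis (ℕ → Bool)
    let b : (ℕ ⊕ J) × β → Set (CantorPsi A) := fun t => piece A t.1 '' t.2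
    have hb : TopologicalSpace.IsTopologicalBasis (range b) := by
      refine TopologicalSpace.isTopologicalBasis_of_isOpen_of_nhds ?_ ?_
      · rintro _ ⟨⟨t, s⟩, rfl⟩
        exact (he t).isOpenMap _ (TopologicalSpace.isOpen_of_mem_countableBasis s.2)
      · intro x U hx hU
        obtain ⟨t, a, rfl⟩ := exists_mem_range_piece hinf x
        obtain ⟨s, hs, has, hsU⟩ := (TopologicalSpace.isBasis_countableBasis
          (ℕ → Bool)).exists_subset_of_mem_open (show a ∈ piece A t ⁻¹' U from hx)
            (hU.preimage (he t).continuous)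
        exact ⟨_, ⟨(t, ⟨s, hs⟩), rfl⟩, ⟨a, has, rfl⟩, image_subset_iff.2 hsU⟩
    calc topWeight (CantorPsi A) ≤ #(range b) := csInf_le' ⟨_, hb, rfl⟩
      _ ≤ #((ℕ ⊕ J) × β) := mk_range_le
      _ ≤ 𝔠 * 𝔠 := by
        rw [mk_prod]
        simp only [lift_id]
        refine mul_le_mul' ?_ ?_
        · simp [hJ]
        · have : #β ≤ ℵ₀ := mk_le_aleph0_iff.2
            (TopologicalSpace.countable_countableBasis _).to_subtype
          exact this.trans aleph0_le_continuum
      _ = 𝔠 := continuum_mul_self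
  · refine le_csInf ⟨_, _, TopologicalSpace.isTopologicalBasis_opens, rfl⟩ ?_
    rintro κ ⟨B, hB, rfl⟩
    have h : ∀ j : J, ∃ s ∈ B, limit j ∈ s ∧ s ⊆ nbhd (A j) j := fun j =>
      hB.exists_subset_of_mem_open (limit_mem_nbhd.2 rfl) (isOpen_nbhd (by simp))
    choose s hs hjs hsn using h
    rw [← hJ]
    refine mk_le_of_injective (f := fun j => (⟨s j, hs j⟩ : B)) fun i j hij => ?_
    have hij : s i = s j := congrArg Subtype.val hij
    exact limit_mem_nbhd.1 (hsn j (hij ▸ hjs i))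

/-! ### Limits at infinity -/

/-- Continuous functions on the space over a Mrówka family have one limit at infinity. -/
theorem exists_limit_at_infinity (hJ : Infinite J) (hinf : ∀ j, (A j).Infinite)
    (hmax : ∀ M : Set ℕ, M.Infinite → ∃ j, (M ∩ A j).Infinite)
    (hlim : ∀ (f : ℕ → ℝ) (l : J → ℝ), (∀ j, Tendsto f (cofinite ⊓ 𝓟 (A j)) (𝓝 (l j))) →
        ∀ r s, r < s → {j | l j ≤ r}.Finite ∨ {j | s ≤ l j}.Finite)
    (g : CantorPsi A → unitInterval) (hg : Continuous g) :
    ∃ t : ℝ, ∀ ε > 0, ∃ F : Finset (ℕ ⊕ J), ∀ x, ε ≤ |(g x : ℝ) - t| →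
      ∃ i ∈ F, x ∈ range (piece A i) := by
  let l : J → ℝ := fun j => g (limit j)
  have hgc : Continuous fun x => (g x : ℝ) := continuous_subtype_val.comp hg
  have hev : ∀ (j : J) (o : Set ℝ), IsOpen o → l j ∈ o →
      ∀ᶠ n in cofinite, n ∈ A j → ∀ c, (g (block (n, c)) : ℝ) ∈ o :=
    fun j o ho hj => (ho.preimage hgc).2 j hj
  have hdich := hlim (fun n => g (block (n, fun _ => false))) l (by
    intro j
    rw [(nhds_basis_opens _).tendsto_right_iff]
    rintro o ⟨hj, ho⟩
    rw [eventually_inf_principal]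
    filter_upwards [hev j o ho hj] with n hn hnA
    exact hn hnA _)
  -- The limit is `sSup S`: below it by `ε` there are finitely many `l j` by definition, above it by
  -- `ε` finitely many by the dichotomy.
  let S : Set ℝ := {r | {j | l j ≤ r}.Finite}
  have hS0 : (-1 : ℝ) ∈ S := by
    have : {j | l j ≤ -1} = ∅ := by
      ext j
      simp only [mem_ofPred_eq, mem_empty_iff_false, iff_false, not_le]
      have := (g (limit j)).2.1
      simp only [l]
      linarith
    simp only [S, mem_ofPred_eq, this, finite_empty]
  have hSb : BddAbove S := by
    refine ⟨1, fun r hr => ?_⟩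
    by_contra! h1
    refine infinite_univ (α := J) (Finite.subset hr fun j _ => ?_)
    exact (g (limit j)).2.2.trans h1.le
  have hfin : ∀ ε > 0, {j | ε ≤ |l j - sSup S|}.Finite := by
    intro ε hε
    obtain ⟨r, hr, hrt⟩ := exists_lt_of_lt_csSup ⟨_, hS0⟩ (sub_lt_self (sSup S) hε)
    have h2 : {j | sSup S + ε ≤ l j}.Finite := by
      refine (hdich (sSup S + ε / 2) _ (by linarith)).resolve_left fun h => ?_
      have := le_csSup hSb h
      linarith
    refine (Finite.union hr h2).subset fun j hj => ?_
    rcases le_abs.1 (show ε ≤ |l j - sSup S| from hj) with h | h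
    · right
      change sSup S + ε ≤ l j
      linarith
    · left
      change l j ≤ r
      linarith
  refine ⟨sSup S, fun ε hε => ?_⟩
  have h2 := hfin (ε / 2) (by linarith)
  -- Deviating blocks not covered by the pieces of deviating limits. An infinite `M` would meet some
  -- `A j` in an infinite set; then `l j` is within `ε / 2` of the limit, so almost all blocks of `A
  -- j` are within `ε`.
  let M : Set ℕ := {n | ∃ c, ε ≤ |(g (block (n, c)) : ℝ) - sSup S|} \
    ⋃ j ∈ {j | ε / 2 ≤ |l j - sSup S|}, A j
  have hM : M.Finite := by
    by_contra hM
    obtain ⟨j, hj⟩ := hmax M hM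
    by_cases hjS : ε / 2 ≤ |l j - sSup S|
    · obtain ⟨n, hn, hnA⟩ := hj.nonempty
      exact hn.2 (mem_biUnion (show j ∈ {j | ε / 2 ≤ |l j - sSup S|} from hjS) hnA)
    · have h := hev j {y | |y - sSup S| < ε} (isOpen_lt (by fun_prop) (by fun_prop)) (by
        change |l j - sSup S| < ε
        linarith)
      rw [eventually_cofinite] at h
      refine hj (h.subset ?_)
      rintro n ⟨⟨⟨c, hc⟩, _⟩, hnA⟩ hn
      exact absurd (hn hnA c) (not_lt.2 hc)
  classical
  refine ⟨hM.toFinset.image Sum.inl ∪ h2.toFinset.image Sum.inr, fun x hx => ?_⟩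
  rcases cases x with ⟨⟨n, c⟩, rfl⟩ | ⟨j, rfl⟩
  · by_cases hn : n ∈ ⋃ j ∈ {j | ε / 2 ≤ |l j - sSup S|}, A j
    · obtain ⟨j, hj, hnj⟩ := mem_iUnion₂.1 hn
      refine ⟨Sum.inr j, by simpa using hj, ?_⟩
      rw [range_piece_inr hinf]
      exact block_mem_nbhd.2 hnj
    · refine ⟨Sum.inl n, ?_, ⟨c, rfl⟩⟩
      refine Finset.mem_union_left _ (Finset.mem_image_of_mem _ (hM.mem_toFinset.2 ⟨⟨c, hx⟩, hn⟩))
  · refine ⟨Sum.inr j, ?_, (limit_mem_range_piece hinf).2 rfl⟩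
    refine Finset.mem_union_right _ (Finset.mem_image_of_mem _ (h2.mem_toFinset.2 ?_))
    have hx : ε ≤ |l j - sSup S| := hx
    change ε / 2 ≤ |l j - sSup S|
    linarith

theorem continuum_le_of_cover (hJ : #J = 𝔠) (hinf : ∀ j, (A j).Infinite) {ι : Type u}
    (F : ι → Finset (ℕ ⊕ J)) (hF : ∀ x : CantorPsi A, ∃ i, ∃ t ∈ F i, x ∈ range (piece A t)) :
    𝔠 ≤ #ι := by
  have h : ∀ j : J, ∃ i, Sum.inr j ∈ F i := by
    intro j
    obtain ⟨i, t, ht, hj⟩ := hF (limit j)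
    rw [limit_mem_range_piece hinf] at hj
    exact ⟨i, hj ▸ ht⟩
  choose i hi using h
  -- Numbering each finite set injects `J` into `ι × ℕ`.
  have hk : ∀ i, ∃ k : ℕ ⊕ J → ℕ, InjOn k (F i) := fun i =>
    countable_iff_exists_injOn.1 (F i).countable_toSet
  choose k hk using hk
  have hinj : Function.Injective fun j => (i j, k (i j) (Sum.inr j)) := by
    intro a b hab
    obtain ⟨h1, h2⟩ := Prod.mk.inj hab
    rw [← h1] at h2
    exact Sum.inr_injective (hk (i a) (hi a) (h1 ▸ hi b) h2)
  have h1 := lift_mk_le_lift_mk_of_injective hinj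
  rw [hJ, mk_prod] at h1
  simp only [lift_continuum, lift_uzero, mk_nat, lift_aleph0] at h1
  by_contra! hlt
  exact absurd h1 (not_le.2 (mul_lt_of_lt aleph0_le_continuum hlt aleph0_lt_continuum))

end CantorPsi

/-! ### Continuous images of small weight -/

theorem secondCountableTopology_of_compact_surjective {K Y : Type*} [TopologicalSpace K]
    [TopologicalSpace Y] [CompactSpace K] [SecondCountableTopology K] [T2Space Y] {f : K → Y}
    (hf : Continuous f) (hsurj : Function.Surjective f) : SecondCountableTopology Y := by
  let β := TopologicalSpace.countableBasis K
  have hβ := TopologicalSpace.isBasis_countableBasis K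
  have : Countable β := (TopologicalSpace.countable_countableBasis K).to_subtype
  -- `W s` consists of the points whose whole fibre lies in the union of `s`; compactness of fibres
  -- makes these sets a base.
  let W : Finset β → Set Y := fun s => (f '' (⋃ b ∈ s, (b : Set K))ᶜ)ᶜ
  have hW : TopologicalSpace.IsTopologicalBasis (range W) := by
    refine TopologicalSpace.isTopologicalBasis_of_isOpen_of_nhds ?_ ?_
    · rintro _ ⟨s, rfl⟩
      have : IsOpen (⋃ b ∈ s, (b : Set K)) :=
        isOpen_biUnion fun b _ => TopologicalSpace.isOpen_of_mem_countableBasis b.2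
      exact (hf.isClosedMap _ this.isClosed_compl).isOpen_compl
    · intro y V hy hV
      have hcomp : IsCompact (f ⁻¹' {y}) := (isClosed_singleton.preimage hf).isCompact
      obtain ⟨s, hs⟩ := hcomp.elim_finite_subcover
        (fun b : {b : β // (b : Set K) ⊆ f ⁻¹' V} => (b.1 : Set K))
        (fun b => TopologicalSpace.isOpen_of_mem_countableBasis b.1.2) (by
          rintro x rfl
          obtain ⟨b, hb, hxb, hbV⟩ := hβ.exists_subset_of_mem_open
            (show x ∈ f ⁻¹' V from hy) (hV.preimage hf)
          exact mem_iUnion.2 ⟨⟨⟨b, hb⟩, hbV⟩, hxb⟩)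
      refine ⟨W (s.map (Function.Embedding.subtype _)), ⟨_, rfl⟩, ?_, ?_⟩
      · rintro ⟨x, hx, rfl⟩
        obtain ⟨b, hb, hxb⟩ := mem_iUnion₂.1 (hs rfl)
        exact hx (mem_iUnion₂.2 ⟨b.1, Finset.mem_map_of_mem _ hb, hxb⟩)
      · intro z hz
        obtain ⟨x, rfl⟩ := hsurj z
        by_contra hzV
        refine hz ⟨x, fun hx => ?_, rfl⟩
        obtain ⟨b, hb, hxb⟩ := mem_iUnion₂.1 hx
        obtain ⟨b', _, rfl⟩ := Finset.mem_map.1 hb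
        exact hzV (b'.2 hxb)
  exact hW.secondCountableTopology (countable_range W)

theorem topWeight_le_aleph0 {Y : Type u} [TopologicalSpace Y] [SecondCountableTopology Y] :
    topWeight Y ≤ ℵ₀ :=
  le_trans (b := #(TopologicalSpace.countableBasis Y))
    (csInf_le' ⟨_, TopologicalSpace.isBasis_countableBasis Y, rfl⟩)
    (mk_le_aleph0_iff.2 (TopologicalSpace.countable_countableBasis Y).to_subtype)

theorem exists_isTopologicalBasis_mk_eq (Y : Type u) [TopologicalSpace Y] :
    ∃ B : Set (Set Y), TopologicalSpace.IsTopologicalBasis B ∧ #B = topWeight Y :=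
  csInf_mem (s := {κ : Cardinal.{u} | ∃ B : Set (Set Y),
    TopologicalSpace.IsTopologicalBasis B ∧ #B = κ})
    ⟨_, _, TopologicalSpace.isTopologicalBasis_opens, rfl⟩

/-- If every bounded function on `X` has a limit modulo finite unions of pieces, then so does
every map into a space whose weight is too small to cover `X` by finite unions of pieces. -/
theorem exists_limit_of_small_weight {X C T : Type} [TopologicalSpace X] {e : T → C → X}
    (hlim : ∀ g : X → unitInterval, Continuous g → ∃ t : ℝ, ∀ ε > 0, ∃ F : Finset T,
      ∀ x, ε ≤ |(g x : ℝ) - t| → ∃ i ∈ F, x ∈ range (e i))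
    {Y : Type u} [TopologicalSpace Y] [CompletelyRegularSpace Y] {f : X → Y} (hf : Continuous f)
    (hcov : ∀ (ι : Type u) (F : ι → Finset T), (∀ x, ∃ i, ∃ t ∈ F i, x ∈ range (e t)) →
      topWeight Y < #ι) :
    ∃ y : Y, ∀ V ∈ 𝓝 y, ∃ F : Finset T, ∀ x, f x ∉ V → ∃ i ∈ F, x ∈ range (e i) := by
  by_contra! hcon
  obtain ⟨B, hB, hBc⟩ := exists_isTopologicalBasis_mk_eq Y
  have key : ∀ y : Y, ∃ b ∈ B, y ∈ b ∧
      ∃ F : Finset T, ∀ x, f x ∈ b → ∃ i ∈ F, x ∈ range (e i) := by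
    intro y
    obtain ⟨V, hV, hVF⟩ := hcon y
    obtain ⟨g, hg, hgy, hg1⟩ := CompletelyRegularSpace.completely_regular y (interior V)ᶜ
      isOpen_interior.isClosed_compl (fun h => h (mem_interior_iff_mem_nhds.2 hV))
    obtain ⟨t, ht⟩ := hlim (g ∘ f) (hg.comp hf)
    -- `g ∘ f` equals `1` off `f ⁻¹' V`, a region that no finite set of pieces covers.
    have ht1 : t = 1 := by
      by_contra hne
      obtain ⟨F, hF⟩ := ht |1 - t| (abs_pos.2 (sub_ne_zero.2 (Ne.symm hne)))
      obtain ⟨x, hx, hxF⟩ := hVF F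
      have hgx : g (f x) = 1 := hg1 fun h => hx (interior_subset h)
      obtain ⟨i, hi, hxi⟩ := hF x (by simp [hgx])
      exact hxF i hi hxi
    obtain ⟨F, hF⟩ := ht (1 / 2) (by norm_num)
    have hopen : IsOpen {z | (g z : ℝ) < 1 / 2} :=
      isOpen_lt (continuous_subtype_val.comp hg) continuous_const
    obtain ⟨b, hb, hyb, hbg⟩ := hB.exists_subset_of_mem_open
      (show y ∈ {z | (g z : ℝ) < 1 / 2} by simp [hgy]) hopen
    refine ⟨b, hb, hyb, F, fun x hx => hF x ?_⟩
    have hx' : (g (f x) : ℝ) < 1 / 2 := hbg hx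
    rw [ht1, abs_sub_comm]
    refine le_trans ?_ (le_abs_self _)
    simp only [Function.comp_apply]
    linarith
  choose b hb hyb F hF using key
  -- Indexing by basic sets rather than by points of `Y` bounds the number of finite sets by the
  -- weight.
  let ι : Type u := range b
  have hι : #ι ≤ topWeight Y := by
    rw [← hBc]
    exact mk_le_mk_of_subset (by rintro _ ⟨y, rfl⟩; exact hb y)
  refine absurd (hcov ι (fun i => F i.2.choose) fun x => ⟨⟨b (f x), f x, rfl⟩, ?_⟩) (not_lt.2 hι)
  refine hF _ x ?_
  rw [(⟨f x, rfl⟩ : b (f x) ∈ range b).choose_spec]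
  exact hyb _

theorem topWeight_le_aleph0_of_homogeneous {X C T : Type} [TopologicalSpace X]
    [TopologicalSpace C] [CompactSpace C] [SecondCountableTopology C] {e : T → C → X}
    (he : ∀ t, Continuous (e t)) {Y : Type u} [TopologicalSpace Y] [T2Space Y] {f : X → Y}
    (hf : Continuous f) (hsurj : Function.Surjective f) {y₀ : Y}
    (hy₀ : ∀ V ∈ 𝓝 y₀, ∃ F : Finset T, ∀ x, f x ∉ V → ∃ i ∈ F, x ∈ range (e i))
    (hY : IsHomogeneousSpace Y) : topWeight Y ≤ ℵ₀ := by
  have hcpt : ∀ F : Finset T, ∃ K : Set Y, IsCompact K ∧ SecondCountableTopology K ∧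
      ∀ x, (∃ i ∈ F, x ∈ range (e i)) → f x ∈ K := by
    intro F
    let : TopologicalSpace F := ⊥
    have : DiscreteTopology F := ⟨rfl⟩
    let φ : F × C → Y := fun p => f (e p.1 p.2)
    have hφ : Continuous φ :=
      continuous_prod_of_discrete_left.2 fun i => hf.comp (he i)
    refine ⟨range φ, isCompact_range hφ, secondCountableTopology_of_compact_surjective
      (continuous_rangeFactorization_iff.2 hφ) rangeFactorization_surjective, ?_⟩
    rintro _ ⟨i, hi, c, rfl⟩
    exact ⟨(⟨i, hi⟩, c), rfl⟩
  by_cases hsub : Subsingleton Y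
  · exact topWeight_le_aleph0
  rw [not_subsingleton_iff_nontrivial] at hsub
  obtain ⟨y₁, hy₁⟩ := exists_ne y₀
  obtain ⟨V, W, hV, hW, hyV, hyW, hd⟩ := t2_separation hy₁.symm
  -- `W` misses the neighbourhood `V` of `y₀`, so it lies in the image of finitely many pieces.
  have hWsc : SecondCountableTopology W := by
    obtain ⟨F, hF⟩ := hy₀ V (hV.mem_nhds hyV)
    obtain ⟨K, -, hK, hFK⟩ := hcpt F
    have hWK : W ⊆ K := by
      intro y hy
      obtain ⟨x, rfl⟩ := hsurj y
      exact hFK x (hF x fun h => disjoint_left.1 hd h hy)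
    exact (IsEmbedding.inclusion hWK).secondCountableTopology
  have hloc : ∀ y : Y, ∃ U : Set Y, IsOpen U ∧ y ∈ U ∧ SecondCountableTopology U := by
    intro y
    obtain ⟨h, rfl⟩ := hY y₁ y
    refine ⟨h '' W, h.isOpenMap _ hW, mem_image_of_mem _ hyW, ?_⟩
    exact (h.image W).symm.isEmbedding.secondCountableTopology
  choose U hUo hyU hU using hloc
  obtain ⟨F, hF⟩ := hy₀ (U y₀) ((hUo y₀).mem_nhds (hyU y₀))
  obtain ⟨K, hK, -, hFK⟩ := hcpt F
  obtain ⟨s, hs⟩ := hK.elim_finite_subcover U hUo fun y _ => mem_iUnion.2 ⟨y, hyU y⟩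
  classical
  have : SecondCountableTopology Y := by
    refine TopologicalSpace.secondCountableTopology_of_countable_cover
      (U := fun y : (insert y₀ s : Finset Y) => U y) (fun y => hUo y) ?_
    rw [eq_univ_iff_forall]
    intro y
    obtain ⟨x, rfl⟩ := hsurj y
    by_cases hx : f x ∈ U y₀
    · exact mem_iUnion.2 ⟨⟨y₀, Finset.mem_insert_self _ _⟩, hx⟩
    · obtain ⟨y, hy, hxy⟩ := mem_iUnion₂.1 (hs (hFK x (hF x hx)))
      exact mem_iUnion.2 ⟨⟨y, Finset.mem_insert_of_mem hy⟩, hxy⟩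
  exact topWeight_le_aleph0

theorem theorem3p1 :
    ∃ (X : Type) (_ : TopologicalSpace X),
      T35Space X ∧ IsHomogeneousSpace X ∧ topWeight X = 𝔠 ∧
        ∀ (Y : Type u) [TopologicalSpace Y] [T35Space Y] (f : X → Y),
          Continuous f → Function.Surjective f →
            ℵ₀ < topWeight Y → topWeight Y < 𝔠 → ¬ IsHomogeneousSpace Y := by
  obtain ⟨J, A, hJ, hinf, hAD, hmax, hlim⟩ := exists_mrowka_family
  have hJinf : Infinite J := by
    rw [infinite_iff, hJ]
    exact aleph0_le_continuum
  have := CantorPsi.t2Space hAD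
  have he := CantorPsi.isOpenEmbedding_piece hinf
  refine ⟨CantorPsi A, inferInstance,
    t35Space_of_cantor_cover _ he (CantorPsi.exists_mem_range_piece hinf),
    CantorPsi.isHomogeneousSpace hinf hAD, CantorPsi.topWeight_eq hJ hinf hAD, ?_⟩
  intro Y _ _ f hf hsurj hlow hhigh hY
  obtain ⟨y, hy⟩ := exists_limit_of_small_weight
    (CantorPsi.exists_limit_at_infinity hJinf hinf hmax hlim) hf
    fun ι F hF => hhigh.trans_le (CantorPsi.continuum_le_of_cover hJ hinf F hF)
  exact absurd (topWeight_le_aleph0_of_homogeneous (fun t => (he t).continuous) hf hsurj hy hY)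
    (not_le.2 hlow)
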